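/- Consider a storage device with charging efficiency $\alpha_c\in(0,1)$, discharging efficiency $\alpha_d\in(0,1)$, round-trip efficiency $\alpha=\alpha_c\alpha_d$ and power storage capacity $S_{\max}\ge 0$ (with no further limits on charging and discharging power), and a fast-ramping generator of capacity $G_{\max}\ge 0$. Let the prediction errors $\Delta_1,\Delta_2,\dots$ be IID Laplace$(\lambda)$ with $\lambda>0$, i.e. with density $\frac{\lambda}{2}e^{-\lambda|\delta|}$, and let the initial stored power $S_1\in[0,S_{\max}]$ be independent of them. The system is operated by the greedy (optimal) policy, whose generation $G_i$, charging power $C_i$ and discharging power $D_i$ are $$(G_i,C_i,D_i)=\begin{cases} \left(0,\ \frac{S_{\max}-S_i}{\alpha_c},\ 0\right) & \text{if } \frac{S_{\max}-S_i}{\alpha_c}\le\Delta_i,\\ (0,\ \Delta_i,\ 0) & \text{if } 0\le\Delta_i<\frac{S_{\max}-S_i}{\alpha_c},\\ (0,\ 0,\ -\Delta_i) & \text{if } -\alpha_d S_i\le\Delta_i<0,\\ (-\Delta_i-\alpha_d S_i,\ 0,\ \alpha_d S_i) & \text{if } -G_{\max}-\alpha_d S_i\le\Delta_i<-\alpha_d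 S_i,\\ (G_{\max},\ 0,\ \alpha_d S_i) & \text{if } \Delta_i<-G_{\max}-\alpha_d S_i, \end{cases}$$ and the stored power evolves by $S_{i+1}=S_i+\alpha_c C_i-D_i/\alpha_d$. Write $\kappa=e^{-(1/\alpha_c-\alpha_d)\lambda S_{\max}/2}$. Then the Markov chain $(S_i)$ on $[0,S_{\max}]$ has exactly one stationary probability distribution. Its cdf is $$F_S(s)=\frac{1-\frac{1+\alpha}{2}\,e^{-(1/\alpha_c-\alpha_d)\lambda s/2}}{1-\alpha\kappa}\qquad (0\le s<S_{\max}),$$ with $F_S(s)=0$ for $s<0$ and $F_S(s)=1$ for $s\ge S_{\max}$; in particular, if $S_{\max}>0$, it has the atoms $\frac{1-\alpha}{2(1-\alpha\kappa)}$ at $0$ and $\frac{(1-\alpha)\kappa}{2(1-\alpha\kappa)}$ at $S_{\max}$. The sequence $(S_i)$ is identically distributed if and only if $S_1$ has this distribution, and in that case every $G_i$ has the cdf $$F_G(g)=1-\frac{1-\alpha}{2(1-\alpha\kappa)}\,e^{-\lambda g}\qquad(0\le g<G_{\max}),$$ with $F_G(g)=0$ for $g<0$ and $F_G(g)=1$ for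 $g\ge G_{\max}$. -/

import Mathlib

open MeasureTheory ProbabilityTheory

/-- The parameters of a single-bus power system with storage whose charging and discharging
rates are unconstrained: charging efficiency `ac`, discharging efficiency `ad`, power storage
capacity `Smax` and fast-ramping generation capacity `Gmax`. -/
structure StorageSystem where
  /-- charging efficiency -/
  ac : ℝ
  /-- discharging efficiency -/
  ad : ℝ
  /-- power storage capacity -/
  Smax : ℝ
  /-- fast-ramping generation capacity -/
  Gmax : ℝ
  ac_pos : 0 < ac
  ac_lt_one : ac < 1
  ad_pos : 0 < ad
  ad_lt_one : ad < 1
  Smax_nonneg : 0 ≤ Smax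
  Gmax_nonneg : 0 ≤ Gmax

/-- A control action: fast-ramping generation, charging power and discharging power. -/
@[ext]
structure ControlAction where
  /-- fast-ramping generation power `G` -/
  gen : ℝ
  /-- charging power `C` -/
  charge : ℝ
  /-- discharging power `D` -/
  discharge : ℝ

namespace StorageSystem

/-- The round-trip efficiency. -/
def eff (sys : StorageSystem) : ℝ := sys.ac * sys.ad

/-- The set of admissible levels of the stored power. -/
abbrev Level (sys : StorageSystem) : Type := Set.Icc (0 : ℝ) sys.Smax

open Classical in
/-- The greedy policy that minimizes the average fast-ramping generation: the action taken when
the stored power is `s` and the net renewable generation (prediction error) is `d`. -/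
noncomputable def policy (sys : StorageSystem) (s d : ℝ) : ControlAction :=
  if (sys.Smax - s) / sys.ac ≤ d then ⟨0, (sys.Smax - s) / sys.ac, 0⟩
  else if 0 ≤ d then ⟨0, d, 0⟩
  else if -sys.ad * s ≤ d then ⟨0, 0, -d⟩
  else if -sys.Gmax - sys.ad * s ≤ d then ⟨-d - sys.ad * s, 0, sys.ad * s⟩
  else ⟨sys.Gmax, 0, sys.ad * s⟩

/-- The stored power in the next time slot under the greedy policy. -/
noncomputable def next (sys : StorageSystem) (s d : ℝ) : ℝ :=
  s + sys.ac * (sys.policy s d).charge - (sys.policy s d).discharge / sys.ad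

theorem next_mem (sys : StorageSystem) (s : sys.Level) (d : ℝ) :
    sys.next s d ∈ Set.Icc (0 : ℝ) sys.Smax := by
  obtain ⟨s, h0, h1⟩ := s
  have hc := sys.ac_pos
  have hd := sys.ad_pos
  have hM := sys.Smax_nonneg
  simp only [next, policy]
  split_ifs with h2 h3 h4 h5
  · have : sys.ac * ((sys.Smax - s) / sys.ac) = sys.Smax - s := by field_simp
    constructor <;> simp [this] <;> linarith
  · have h6 : d * sys.ac < sys.Smax - s := (lt_div_iff₀ hc).1 (not_le.1 h2)
    have h7 : 0 ≤ sys.ac * d := by positivity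
    constructor <;> simp <;> nlinarith
  · have h6 : -d / sys.ad ≤ s := (div_le_iff₀ hd).2 (by nlinarith)
    have h7 : 0 ≤ -d / sys.ad := div_nonneg (by linarith) hd.le
    constructor <;> simp only [mul_zero, add_zero] <;> linarith
  · have : sys.ad * s / sys.ad = s := by field_simp
    constructor <;> simp [this, hM]
  · have : sys.ad * s / sys.ad = s := by field_simp
    constructor <;> simp [this, hM]

/-- `next` as a map into the set of admissible levels. -/
noncomputable def step (sys : StorageSystem) (s : sys.Level) (d : ℝ) : sys.Level :=
  ⟨sys.next s d, sys.next_mem s d⟩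

/-- The fast-ramping generation under the greedy policy. -/
noncomputable def generation (sys : StorageSystem) (s : sys.Level) (d : ℝ) : ℝ :=
  (sys.policy s d).gen

theorem measurable_step (sys : StorageSystem) :
    Measurable fun p : sys.Level × ℝ => sys.step p.1 p.2 := by
  refine Measurable.subtype_mk ?_
  simp only [next, policy, apply_ite ControlAction.charge, apply_ite ControlAction.discharge]
  have hs : Measurable fun p : sys.Level × ℝ => (p.1 : ℝ) := by fun_prop
  have hd : Measurable fun p : sys.Level × ℝ => p.2 := measurable_snd
  have m1 : MeasurableSet {p : sys.Level × ℝ | (sys.Smax - (p.1 : ℝ)) / sys.ac ≤ p.2} :=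
    measurableSet_le (by fun_prop) hd
  have m2 : MeasurableSet {p : sys.Level × ℝ | 0 ≤ p.2} := measurableSet_le (by fun_prop) hd
  have m3 : MeasurableSet {p : sys.Level × ℝ | -sys.ad * (p.1 : ℝ) ≤ p.2} :=
    measurableSet_le (by fun_prop) hd
  have m4 : MeasurableSet {p : sys.Level × ℝ | -sys.Gmax - sys.ad * (p.1 : ℝ) ≤ p.2} :=
    measurableSet_le (by fun_prop) hd
  refine Measurable.sub (hs.add (Measurable.const_mul ?_ _)) (Measurable.div_const ?_ _)
  · exact .ite m1 (by fun_prop) (.ite m2 hd (.ite m3 (by fun_prop) (.ite m4 (by fun_prop)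
      (by fun_prop))))
  · exact .ite m1 (by fun_prop) (.ite m2 (by fun_prop) (.ite m3 (by fun_prop)
      (.ite m4 (by fun_prop) (by fun_prop))))

end StorageSystem

/-- The Laplace distribution with rate `lam`, with density `(lam / 2) * exp (-lam * |x|)`. -/
noncomputable def laplaceMeasure (lam : ℝ) : Measure ℝ :=
  volume.withDensity fun x => ENNReal.ofReal (lam / 2 * Real.exp (-lam * |x|))

namespace StorageSystem

/-- The transition kernel of the stored power under the greedy policy and independent
Laplace prediction errors: from `s` the chain moves to `step s d` with `d` Laplace distributed. -/
noncomputable def kernel (sys : StorageSystem) (lam : ℝ) : Kernel sys.Level sys.Level where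
  toFun s := (laplaceMeasure lam).map (sys.step s)
  measurable' := by
    have : SFinite (laplaceMeasure lam) := by unfold laplaceMeasure; infer_instance
    refine Measure.measurable_of_measurable_coe _ fun t ht => ?_
    have h : ∀ s : sys.Level, (laplaceMeasure lam).map (sys.step s) t
        = laplaceMeasure lam (Prod.mk s ⁻¹' ((fun p : sys.Level × ℝ => sys.step p.1 p.2) ⁻¹' t)) :=
      fun s => Measure.map_apply (sys.measurable_step.comp measurable_prodMk_left) ht
    simp only [h]
    exact measurable_measure_prodMk_left (sys.measurable_step ht)

/-- The law of the fast-ramping generation when the stored power has law `π` and the prediction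
error is independent of it and Laplace distributed. -/
noncomputable def generationLaw (sys : StorageSystem) (lam : ℝ) (π : Measure sys.Level) :
    Measure ℝ :=
  (π.prod (laplaceMeasure lam)).map fun p => sys.generation p.1 p.2

/-- `S` is the stored power sequence under the greedy policy, driven by the IID Laplace
prediction errors `Δ`, with an initial value that is independent of them. -/
structure IsStoredPower (sys : StorageSystem) (lam : ℝ) {Ω : Type*} [MeasurableSpace Ω]
    (P : Measure Ω) (Δ : ℕ → Ω → ℝ) (S : ℕ → Ω → sys.Level) : Prop where
  measurable_error : ∀ i, Measurable (Δ i)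
  iIndep_error : iIndepFun Δ P
  law_error : ∀ i, P.map (Δ i) = laplaceMeasure lam
  measurable_init : Measurable (S 0)
  indep_init : IndepFun (S 0) (fun ω i => Δ i ω) P
  succ : ∀ i ω, S (i + 1) ω = sys.step (S i ω) (Δ i ω)

open Classical in
/-- The closed form of the cdf of the stationary stored power. -/
noncomputable def storedCDF (sys : StorageSystem) (lam s : ℝ) : ℝ :=
  if s < 0 then 0
  else if s < sys.Smax then
    (1 - (1 + sys.eff) / 2 * Real.exp (-(1 / sys.ac - sys.ad) * lam * s / 2)) /
      (1 - sys.eff * Real.exp (-(1 / sys.ac - sys.ad) * lam * sys.Smax / 2))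
  else 1

open Classical in
/-- The closed form of the cdf of the stationary fast-ramping generation. -/
noncomputable def generationCDF (sys : StorageSystem) (lam g : ℝ) : ℝ :=
  if g < 0 then 0
  else if g < sys.Gmax then
    1 - (1 - sys.eff) /
      (2 * (1 - sys.eff * Real.exp (-(1 / sys.ac - sys.ad) * lam * sys.Smax / 2))) *
        Real.exp (-lam * g)
  else 1

end StorageSystem

/-! From `s`, the chain jumps above `t > s` with probability `exp (-(lam / ac) * (t - s)) / 2` and
below `t < s` with probability `exp (-(lam * ad) * (s - t)) / 2`. Write the two rates as `γ + β` and
`γ - β`. Weighting the starting point by `exp (-β * s)` makes both probabilities decay at the rate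
`γ`, up to the common factor `exp (-β * t) / 2`, and under the measure `δ_0 + δ_Smax + γ * Lebesgue`
the function `exp (-γ * |s - t|)` has mass `1` on either side of every level `t < Smax`. So the law
with density proportional to `exp (-β * s)` with respect to this measure has equal upward and
downward flux through every level, which makes it invariant, and its cdf, its atoms and the law of
the generation are explicit exponential integrals. It is the only invariant law because every level
jumps to `0` with a probability that is bounded below: two distinct invariant laws would yield two
mutually singular invariant measures, both charging `0`.
-/

section Laplace

variable {lam x : ℝ}

instance instSFiniteLaplaceMeasure : SFinite (laplaceMeasure lam) := by
  unfold laplaceMeasure; infer_instance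

instance instNullSingletonClassLaplaceMeasure : NullSingletonClass (laplaceMeasure lam) := by
  unfold laplaceMeasure; infer_instance

theorem laplaceMeasure_Iic_of_nonpos (hlam : 0 < lam) (hx : x ≤ 0) :
    laplaceMeasure lam (Set.Iic x) = ENNReal.ofReal (Real.exp (lam * x) / 2) := by
  have hdensity : Set.EqOn (fun y => ENNReal.ofReal (lam / 2 * Real.exp (-lam * |y|)))
      (fun y => ENNReal.ofReal (lam / 2 * Real.exp (lam * y))) (Set.Iic x) := fun y hy => by
    simp [abs_of_nonpos (le_trans hy hx)]
  rw [laplaceMeasure, withDensity_apply _ measurableSet_Iic,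
    setLIntegral_congr_fun measurableSet_Iic hdensity,
    ← ofReal_integral_eq_lintegral_ofReal ((integrableOn_exp_mul_Iic hlam x).const_mul _)
      (ae_of_all _ fun y => by positivity), integral_const_mul, integral_exp_mul_Iic hlam]
  congr 1
  field_simp

theorem laplaceMeasure_Iio_of_nonpos (hlam : 0 < lam) (hx : x ≤ 0) :
    laplaceMeasure lam (Set.Iio x) = ENNReal.ofReal (Real.exp (lam * x) / 2) := by
  rw [measure_congr Iio_ae_eq_Iic, laplaceMeasure_Iic_of_nonpos hlam hx]

theorem laplaceMeasure_Ioi_of_nonneg (hlam : 0 < lam) (hx : 0 ≤ x) :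
    laplaceMeasure lam (Set.Ioi x) = ENNReal.ofReal (Real.exp (-(lam * x)) / 2) := by
  have hdensity : Set.EqOn (fun y => ENNReal.ofReal (lam / 2 * Real.exp (-lam * |y|)))
      (fun y => ENNReal.ofReal (lam / 2 * Real.exp (-lam * y))) (Set.Ioi x) := fun y hy => by
    simp [abs_of_nonneg (le_trans hx (le_of_lt hy))]
  have hneg := neg_lt_zero.2 hlam
  rw [laplaceMeasure, withDensity_apply _ measurableSet_Ioi,
    setLIntegral_congr_fun measurableSet_Ioi hdensity,
    ← ofReal_integral_eq_lintegral_ofReal ((integrableOn_exp_mul_Ioi hneg x).const_mul _)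
      (ae_of_all _ fun y => by positivity), integral_const_mul, integral_exp_mul_Ioi hneg, neg_mul]
  congr 1
  field_simp

theorem isProbabilityMeasure_laplaceMeasure (hlam : 0 < lam) :
    IsProbabilityMeasure (laplaceMeasure lam) := by
  constructor
  rw [← Set.Iic_union_Ioi (a := (0 : ℝ)),
    measure_union (Set.Iic_disjoint_Ioi le_rfl) measurableSet_Ioi,
    laplaceMeasure_Iic_of_nonpos hlam le_rfl, laplaceMeasure_Ioi_of_nonneg hlam le_rfl,
    ← ENNReal.ofReal_add (by positivity) (by positivity)]
  norm_num

end Laplace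

section Invariant

variable {α : Type*} [MeasurableSpace α] {κ : Kernel α α} {μ ν ρ : Measure α}

theorem comp_apply_eq_of_setLIntegral_compl_eq [IsMarkovKernel κ] {A : Set α}
    (hA : MeasurableSet A) (hflux : ∫⁻ x in A, κ x Aᶜ ∂μ = ∫⁻ x in Aᶜ, κ x A ∂μ) :
    (κ ∘ₘ μ) A = μ A :=
  calc (κ ∘ₘ μ) A = ∫⁻ x in A, κ x A ∂μ + ∫⁻ x in Aᶜ, κ x A ∂μ := by
        rw [Measure.bind_apply hA κ.aemeasurable, lintegral_add_compl _ hA]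
    _ = ∫⁻ x in A, (κ x A + κ x Aᶜ) ∂μ := by
        rw [← hflux, lintegral_add_left (κ.measurable_coe hA)]
    _ = μ A := by simp [prob_add_prob_compl hA]

theorem invariant_of_setLIntegral_Iic_eq_setLIntegral_Ioi [LinearOrder α] [TopologicalSpace α]
    [OrderTopology α] [SecondCountableTopology α] [BorelSpace α] [IsMarkovKernel κ]
    [IsFiniteMeasure μ]
    (hflux : ∀ t, ∫⁻ x in Set.Iic t, κ x (Set.Ioi t) ∂μ = ∫⁻ x in Set.Ioi t, κ x (Set.Iic t) ∂μ) :
    κ.Invariant μ := by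
  refine Measure.ext_of_Iic _ _ fun t =>
    comp_apply_eq_of_setLIntegral_compl_eq measurableSet_Iic ?_
  rw [Set.compl_Iic]
  exact hflux t

theorem comp_measure_mono (h : μ ≤ ν) : κ ∘ₘ μ ≤ κ ∘ₘ ν :=
  Measure.le_iff.2 fun s hs => by
    rw [Measure.bind_apply hs κ.aemeasurable, Measure.bind_apply hs κ.aemeasurable]
    exact lintegral_mono' h le_rfl

theorem invariant_sub [IsMarkovKernel κ] [IsFiniteMeasure μ] [IsFiniteMeasure ν]
    (hμ : κ.Invariant μ) (hν : κ.Invariant ν) : κ.Invariant (μ - ν) := by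
  refine (Measure.eq_of_le_of_measure_univ_eq ?_ Measure.comp_apply_univ.symm).symm
  refine Measure.sub_le_iff_le_add.2 ?_
  calc μ = κ ∘ₘ μ := hμ.symm
    _ ≤ κ ∘ₘ (μ - ν + ν) := comp_measure_mono (Measure.sub_le_iff_le_add.1 le_rfl)
    _ = κ ∘ₘ (μ - ν) + ν := by rw [Measure.comp_add, hν.def]

theorem smul_le_of_invariant (hκ : ∀ x, ρ ≤ κ x) (hμ : κ.Invariant μ) : μ Set.univ • ρ ≤ μ :=
  Measure.le_iff.2 fun s hs =>
    calc μ Set.univ * ρ s = ∫⁻ _, ρ s ∂μ := by rw [lintegral_const, mul_comm]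
      _ ≤ ∫⁻ x, κ x s ∂μ := lintegral_mono fun x => hκ x s
      _ = μ s := by rw [← Measure.bind_apply hs κ.aemeasurable, hμ.def]

theorem absolutelyContinuous_of_invariant (hκ : ∀ x, ρ ≤ κ x) (hμ : κ.Invariant μ) (hμ0 : μ ≠ 0) :
    ρ ≪ μ :=
  (Measure.absolutelyContinuous_smul (Measure.measure_univ_ne_zero.2 hμ0)).trans
    (smul_le_of_invariant hκ hμ).absolutelyContinuous

theorem eq_of_measure_sub_eq_zero [IsProbabilityMeasure μ] [IsProbabilityMeasure ν]
    (h : μ - ν = 0) : μ = ν :=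
  Measure.eq_of_le_of_isProbabilityMeasure
    ((Measure.sub_le_iff_le_add.1 h.le).trans_eq (zero_add ν))

theorem eq_of_invariant_of_le [IsMarkovKernel κ] [IsProbabilityMeasure μ]
    [IsProbabilityMeasure ν] (hρ : ρ ≠ 0) (hκ : ∀ x, ρ ≤ κ x) (hμ : κ.Invariant μ)
    (hν : κ.Invariant ν) : μ = ν := by
  have hsingular : (μ - ν) ⟂ₘ (ν - μ) := Measure.mutually_singular_measure_sub
  have hzero : μ - ν = 0 ∨ ν - μ = 0 := by
    by_contra! hne
    exact hρ (Measure.MutuallySingular.self_iff ρ |>.1 (hsingular.mono_ac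
      (absolutelyContinuous_of_invariant hκ (invariant_sub hμ hν) hne.1)
      (absolutelyContinuous_of_invariant hκ (invariant_sub hν hμ) hne.2)))
  exact hzero.elim eq_of_measure_sub_eq_zero fun h => (eq_of_measure_sub_eq_zero h).symm

end Invariant

section Recursion

variable {Ω α β : Type*} [MeasurableSpace α] [MeasurableSpace β] {X : ℕ → Ω → α} {Δ : ℕ → Ω → β}
  {F : α → β → α}

theorem exists_measurable_eq_of_recursion (hF : Measurable fun p : α × β => F p.1 p.2)
    (hrec : ∀ i ω, X (i + 1) ω = F (X i ω) (Δ i ω)) (i : ℕ) :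
    ∃ f : α × (Finset.range i → β) → α, Measurable f ∧ ∀ ω, X i ω = f (X 0 ω, fun j => Δ j ω) := by
  induction i with
  | zero => exact ⟨Prod.fst, measurable_fst, fun _ => rfl⟩
  | succ i ih =>
    obtain ⟨f, hf, hX⟩ := ih
    refine ⟨fun p => F (f (p.1, fun j => p.2 ⟨j, Finset.range_subset_range.2 i.le_succ j.2⟩))
      (p.2 ⟨i, Finset.self_mem_range_succ i⟩), ?_, fun ω => by rw [hrec, hX]⟩
    exact hF.comp (.prodMk (hf.comp (by fun_prop)) (by fun_prop))

variable [MeasurableSpace Ω]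

theorem measurable_of_recursion (hF : Measurable fun p : α × β => F p.1 p.2)
    (hX : Measurable (X 0)) (hΔ : ∀ i, Measurable (Δ i))
    (hrec : ∀ i ω, X (i + 1) ω = F (X i ω) (Δ i ω)) (i : ℕ) : Measurable (X i) := by
  induction i with
  | zero => exact hX
  | succ i ih =>
    rw [funext (hrec i)]
    exact hF.comp (ih.prodMk (hΔ i))

theorem indepFun_prodMk_left {γ : Type*} [MeasurableSpace γ] {P : Measure Ω}
    [IsProbabilityMeasure P] {X : Ω → α} {Y : Ω → β} {Z : Ω → γ} (hX : Measurable X)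
    (hY : Measurable Y) (hZ : Measurable Z)
    (hXYZ : IndepFun X (fun ω => (Y ω, Z ω)) P) (hYZ : IndepFun Y Z P) :
    IndepFun (fun ω => (X ω, Y ω)) Z P := by
  have hXY : IndepFun X Y P := hXYZ.comp measurable_id measurable_fst
  rw [indepFun_iff_map_prod_eq_prod_map_map (by fun_prop) (by fun_prop)] at hXYZ hYZ hXY ⊢
  rw [hXY, ← MeasurableEquiv.prodAssoc.map_measurableEquiv_injective.eq_iff,
    Measure.prodAssoc_prod, ← hYZ, ← hXYZ, Measure.map_map (by fun_prop) (by fun_prop)]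
  rfl

theorem indepFun_of_recursion {P : Measure Ω} (hF : Measurable fun p : α × β => F p.1 p.2)
    (hX : Measurable (X 0)) (hΔ : ∀ i, Measurable (Δ i))
    (hrec : ∀ i ω, X (i + 1) ω = F (X i ω) (Δ i ω)) (hindep : iIndepFun Δ P)
    (hinit : IndepFun (X 0) (fun ω i => Δ i ω) P) (i : ℕ) : IndepFun (X i) (Δ i) P := by
  have := hindep.isProbabilityMeasure
  obtain ⟨f, hf, hXf⟩ := exists_measurable_eq_of_recursion hF hrec i
  have hpast : IndepFun (fun ω (j : Finset.range i) => Δ j ω) (Δ i) P :=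
    (hindep.indepFun_finset (Finset.range i) {i} (by simp) hΔ).comp measurable_id
      (measurable_pi_apply (⟨i, Finset.mem_singleton_self i⟩ : ({i} : Finset ℕ)))
  have hstart : IndepFun (X 0) (fun ω => (fun j : Finset.range i => Δ j ω, Δ i ω)) P :=
    hinit.comp (ψ := fun x : ℕ → β => (fun j : Finset.range i => x j, x i)) measurable_id
      (by fun_prop)
  rw [funext hXf]
  exact (indepFun_prodMk_left hX (by fun_prop) (hΔ i) hstart hpast).comp hf measurable_id

end Recursion

section Cdf

variable {μ : Measure ℝ} [IsProbabilityMeasure μ] {x : ℝ}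

theorem cdf_eq_zero_of_ae_lt (h : ∀ᵐ y ∂μ, x < y) : cdf μ x = 0 := by
  rw [cdf_eq_real, measureReal_eq_zero_iff, measure_eq_zero_iff_ae_notMem]
  exact h.mono fun y hy => not_le.2 hy

theorem cdf_eq_one_of_ae_le (h : ∀ᵐ y ∂μ, y ≤ x) : cdf μ x = 1 := by
  have hfull : μ (Set.Iic x) = 1 := prob_compl_eq_zero_iff measurableSet_Iic |>.1 h
  rw [cdf_eq_real, Measure.real, hfull, ENNReal.toReal_one]

end Cdf

section ExponentialIntegrals

theorem mul_integral_exp_neg_mul (c a b : ℝ) :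
    c * ∫ x in a..b, Real.exp (-(c * x)) = Real.exp (-(c * a)) - Real.exp (-(c * b)) := by
  have h := intervalIntegral.mul_integral_comp_mul_left (a := a) (b := b) (f := Real.exp) (-c)
  rw [integral_exp] at h
  simp only [neg_mul] at h
  linarith

theorem mul_integral_exp_neg_mul_sub_left (c t b : ℝ) :
    c * ∫ x in t..b, Real.exp (-(c * (x - t))) = 1 - Real.exp (-(c * (b - t))) := by
  rw [intervalIntegral.integral_comp_sub_right (fun x => Real.exp (-(c * x))),
    mul_integral_exp_neg_mul]
  simp

theorem mul_integral_exp_neg_mul_sub_right (c a t : ℝ) :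
    c * ∫ x in a..t, Real.exp (-(c * (t - x))) = 1 - Real.exp (-(c * (t - a))) := by
  rw [intervalIntegral.integral_comp_sub_left (fun x => Real.exp (-(c * x))),
    mul_integral_exp_neg_mul]
  simp

theorem setLIntegral_Ioc_ofReal {g : ℝ → ℝ} (hg : Continuous g) (hg0 : ∀ x, 0 ≤ g x) {a b : ℝ}
    (hab : a ≤ b) :
    ∫⁻ x in Set.Ioc a b, ENNReal.ofReal (g x) = ENNReal.ofReal (∫ x in a..b, g x) := by
  rw [intervalIntegral.integral_of_le hab,
    ofReal_integral_eq_lintegral_ofReal hg.integrableOn_Ioc (ae_of_all _ hg0)]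

end ExponentialIntegrals

section EndpointMeasure

variable {a b : ℝ}

/-- The measure `δ_a + δ_b + γ · Lebesgue` on the interval `[a, b]`, the reference measure against
which the stationary law has an exponential density. -/
noncomputable def endpointMeasure (hab : a ≤ b) (γ : ℝ) : Measure (Set.Icc a b) :=
  Measure.dirac (⟨a, Set.left_mem_Icc.2 hab⟩ : Set.Icc a b) +
    Measure.dirac (⟨b, Set.right_mem_Icc.2 hab⟩ : Set.Icc a b) +
      ENNReal.ofReal γ • Measure.comap Subtype.val volume

variable (hab : a ≤ b) {γ : ℝ} {g : ℝ → ℝ}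

theorem setLIntegral_endpointMeasure {f : ℝ → ENNReal} (hf : Measurable f)
    {A : Set (Set.Icc a b)} (hA : MeasurableSet A) :
    ∫⁻ s in A, f s ∂(endpointMeasure hab γ) =
      (Subtype.val '' A).indicator f a + (Subtype.val '' A).indicator f b +
        ENNReal.ofReal γ * ∫⁻ s in Subtype.val '' A, f s := by
  classical
  have hf' : Measurable fun s : Set.Icc a b => f s := by fun_prop
  simp only [endpointMeasure, Measure.restrict_add, Measure.restrict_smul, lintegral_add_measure,
    lintegral_smul_measure, setLIntegral_dirac' hf' hA, setLIntegral_subtype measurableSet_Icc,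
    smul_eq_mul, Set.indicator_apply, Set.mem_image, Subtype.exists]
  simp [hab]

theorem setLIntegral_Iic_endpointMeasure (hγ : 0 ≤ γ) (hg : Continuous g) (hg0 : ∀ x, 0 ≤ g x)
    {t : Set.Icc a b} (ht : (t : ℝ) < b) :
    ∫⁻ s in Set.Iic t, ENNReal.ofReal (g s) ∂(endpointMeasure hab γ) =
      ENNReal.ofReal (g a + γ * ∫ s in a..t, g s) := by
  have hint : 0 ≤ ∫ s in a..t, g s := intervalIntegral.integral_nonneg t.2.1 fun s _ => hg0 s
  rw [setLIntegral_endpointMeasure hab (f := fun s => ENNReal.ofReal (g s)) (by fun_prop)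
      measurableSet_Iic, Set.image_subtype_val_Icc_Iic,
    Set.indicator_of_mem (Set.left_mem_Icc.2 t.2.1),
    Set.indicator_of_notMem fun h => ht.not_ge h.2, ← setLIntegral_congr Ioc_ae_eq_Icc,
    setLIntegral_Ioc_ofReal hg hg0 t.2.1, add_zero, ← ENNReal.ofReal_mul hγ,
    ← ENNReal.ofReal_add (hg0 a) (mul_nonneg hγ hint)]

theorem setLIntegral_Ioi_endpointMeasure (hγ : 0 ≤ γ) (hg : Continuous g) (hg0 : ∀ x, 0 ≤ g x)
    {t : Set.Icc a b} (ht : (t : ℝ) < b) :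
    ∫⁻ s in Set.Ioi t, ENNReal.ofReal (g s) ∂(endpointMeasure hab γ) =
      ENNReal.ofReal (g b + γ * ∫ s in t..b, g s) := by
  have hint : 0 ≤ ∫ s in t..b, g s := intervalIntegral.integral_nonneg t.2.2 fun s _ => hg0 s
  rw [setLIntegral_endpointMeasure hab (f := fun s => ENNReal.ofReal (g s)) (by fun_prop)
      measurableSet_Ioi, Set.image_subtype_val_Icc_Ioi,
    Set.indicator_of_notMem fun h => t.2.1.not_gt h.1,
    Set.indicator_of_mem (Set.right_mem_Ioc.2 ht),
    setLIntegral_Ioc_ofReal hg hg0 t.2.2, zero_add, ← ENNReal.ofReal_mul hγ,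
    ← ENNReal.ofReal_add (hg0 b) (mul_nonneg hγ hint)]

theorem lintegral_endpointMeasure (hγ : 0 ≤ γ) (hg : Continuous g) (hg0 : ∀ x, 0 ≤ g x) :
    ∫⁻ s, ENNReal.ofReal (g s) ∂(endpointMeasure hab γ) =
      ENNReal.ofReal (g a + g b + γ * ∫ s in a..b, g s) := by
  have hint : 0 ≤ ∫ s in a..b, g s := intervalIntegral.integral_nonneg hab fun s _ => hg0 s
  rw [← setLIntegral_univ, setLIntegral_endpointMeasure hab (f := fun s => ENNReal.ofReal (g s))
      (by fun_prop) .univ, Set.image_univ, Subtype.range_coe,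
    Set.indicator_of_mem (Set.left_mem_Icc.2 hab), Set.indicator_of_mem (Set.right_mem_Icc.2 hab),
    ← setLIntegral_congr Ioc_ae_eq_Icc, setLIntegral_Ioc_ofReal hg hg0 hab,
    ← ENNReal.ofReal_mul hγ, ← ENNReal.ofReal_add (hg0 a) (hg0 b),
    ← ENNReal.ofReal_add (add_nonneg (hg0 a) (hg0 b)) (mul_nonneg hγ hint)]

theorem setLIntegral_Iic_endpointMeasure_exp (hγ : 0 ≤ γ) {t : Set.Icc a b} (ht : (t : ℝ) < b) :
    ∫⁻ s in Set.Iic t, ENNReal.ofReal (Real.exp (-(γ * (t - s)))) ∂(endpointMeasure hab γ) = 1 := by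
  rw [setLIntegral_Iic_endpointMeasure hab (g := fun s => Real.exp (-(γ * (t - s)))) hγ
      (by fun_prop) (fun _ => (Real.exp_pos _).le) ht,
    mul_integral_exp_neg_mul_sub_right, add_sub_cancel, ENNReal.ofReal_one]

theorem setLIntegral_Ioi_endpointMeasure_exp (hγ : 0 ≤ γ) {t : Set.Icc a b} (ht : (t : ℝ) < b) :
    ∫⁻ s in Set.Ioi t, ENNReal.ofReal (Real.exp (-(γ * (s - t)))) ∂(endpointMeasure hab γ) = 1 := by
  rw [setLIntegral_Ioi_endpointMeasure hab (g := fun s => Real.exp (-(γ * (s - t)))) hγ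
      (by fun_prop) (fun _ => (Real.exp_pos _).le) ht,
    mul_integral_exp_neg_mul_sub_left, add_sub_cancel, ENNReal.ofReal_one]

theorem lintegral_endpointMeasure_exp (hγ : 0 ≤ γ) :
    ∫⁻ s, ENNReal.ofReal (Real.exp (-(γ * (s - a)))) ∂(endpointMeasure hab γ) = 2 := by
  rw [lintegral_endpointMeasure hab (g := fun s => Real.exp (-(γ * (s - a)))) hγ
      (by fun_prop) (fun _ => (Real.exp_pos _).le),
    mul_integral_exp_neg_mul_sub_left, add_add_sub_cancel, sub_self, mul_zero, neg_zero,
    Real.exp_zero, one_add_one_eq_two, ENNReal.ofReal_ofNat]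

theorem endpointMeasure_singleton_left (h : a < b) :
    endpointMeasure h.le γ {⟨a, Set.left_mem_Icc.2 h.le⟩} = 1 := by
  rw [← setLIntegral_one, setLIntegral_endpointMeasure h.le measurable_const
    (measurableSet_singleton _), Set.image_singleton]
  simp [h.ne']

theorem endpointMeasure_singleton_right (h : a < b) :
    endpointMeasure h.le γ {⟨b, Set.right_mem_Icc.2 h.le⟩} = 1 := by
  rw [← setLIntegral_one, setLIntegral_endpointMeasure h.le measurable_const
    (measurableSet_singleton _), Set.image_singleton]
  simp [h.ne]

end EndpointMeasure

namespace StorageSystem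

variable (sys : StorageSystem) {lam d g : ℝ} (s : sys.Level)

theorem coe_step_of_nonneg (hd : 0 ≤ d) : (sys.step s d : ℝ) = min sys.Smax (s + sys.ac * d) := by
  have hc := sys.ac_pos
  have hcap : sys.ac * ((sys.Smax - s) / sys.ac) = sys.Smax - s := mul_div_cancel₀ _ hc.ne'
  simp only [step, next, policy, hd, if_true]
  split_ifs with hfull
  · have : sys.Smax - s ≤ d * sys.ac := (div_le_iff₀ hc).1 hfull
    rw [min_eq_left (by linarith), hcap, zero_div, add_sub_cancel, sub_zero]
  · have : d * sys.ac < sys.Smax - s := (lt_div_iff₀ hc).1 (not_le.1 hfull)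
    rw [min_eq_right (by linarith), zero_div, sub_zero]

theorem coe_step_of_neg (hd : d < 0) : (sys.step s d : ℝ) = max 0 (s + d / sys.ad) := by
  have hroom : 0 ≤ (sys.Smax - s) / sys.ac := div_nonneg (sub_nonneg.2 s.2.2) sys.ac_pos.le
  have hempty : sys.ad * s / sys.ad = s := mul_div_cancel_left₀ _ sys.ad_pos.ne'
  simp only [step, next, policy, (hd.trans_le hroom).not_ge, hd.not_ge, if_false]
  by_cases hd' : -sys.ad * s ≤ d
  · have : -s ≤ d / sys.ad := (le_div_iff₀ sys.ad_pos).2 (by linarith)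
    rw [if_pos hd', max_eq_right (by linarith)]
    ring
  · have : d / sys.ad ≤ -s := (div_le_iff₀ sys.ad_pos).2 (by linarith)
    rw [if_neg hd', max_eq_left (by linarith)]
    split_ifs <;> simp [hempty]

variable {s} {t : sys.Level}

theorem lt_step_iff (hst : s ≤ t) (ht : (t : ℝ) < sys.Smax) :
    t < sys.step s d ↔ (t - s) / sys.ac < d := by
  have hst' : (s : ℝ) ≤ t := hst
  rw [← Subtype.coe_lt_coe, div_lt_iff₀ sys.ac_pos]
  rcases le_or_gt 0 d with hd | hd
  · rw [sys.coe_step_of_nonneg s hd, lt_min_iff, ← sub_lt_iff_lt_add', mul_comm]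
    exact and_iff_right ht
  · rw [sys.coe_step_of_neg s hd, lt_max_iff]
    have hdown : d / sys.ad < 0 := div_neg_of_neg_of_pos hd sys.ad_pos
    have hdown' : d * sys.ac < 0 := mul_neg_of_neg_of_pos hd sys.ac_pos
    refine iff_of_false (not_or_intro t.2.1.not_gt ?_) ?_ <;> linarith

theorem step_le_iff (hts : t < s) : sys.step s d ≤ t ↔ d ≤ -(sys.ad * (s - t)) := by
  have hts' : (t : ℝ) < s := hts
  have hloss : 0 < sys.ad * (s - t) := mul_pos sys.ad_pos (sub_pos.2 hts')
  rw [← Subtype.coe_le_coe]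
  rcases le_or_gt 0 d with hd | hd
  · rw [sys.coe_step_of_nonneg s hd, min_le_iff]
    have hup : 0 ≤ sys.ac * d := mul_nonneg sys.ac_pos.le hd
    refine iff_of_false (not_or_intro (hts'.trans_le s.2.2).not_ge ?_) ?_ <;> linarith
  · rw [sys.coe_step_of_neg s hd, max_le_iff, ← le_sub_iff_add_le', div_le_iff₀ sys.ad_pos,
      and_iff_right t.2.1, ← mul_neg, neg_sub, mul_comm]

theorem step_eq_zero (hd : d < -(sys.ad * sys.Smax)) :
    sys.step s d = ⟨0, Set.left_mem_Icc.2 sys.Smax_nonneg⟩ := by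
  have hcap : 0 ≤ sys.ad * sys.Smax := mul_nonneg sys.ad_pos.le sys.Smax_nonneg
  have hs : sys.ad * s ≤ sys.ad * sys.Smax := mul_le_mul_of_nonneg_left s.2.2 sys.ad_pos.le
  have hdrain : d / sys.ad ≤ -s := (div_le_iff₀ sys.ad_pos).2 (by linarith)
  rw [Subtype.ext_iff, sys.coe_step_of_neg s (by linarith), max_eq_left (by linarith)]

theorem measurable_generation :
    Measurable fun p : sys.Level × ℝ => sys.generation p.1 p.2 := by
  simp only [generation, policy, apply_ite ControlAction.gen]
  have hd : Measurable fun p : sys.Level × ℝ => p.2 := measurable_snd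
  exact .ite (measurableSet_le (by fun_prop) hd) (by fun_prop)
    (.ite (measurableSet_le (by fun_prop) hd) (by fun_prop)
      (.ite (measurableSet_le (by fun_prop) hd) (by fun_prop)
        (.ite (measurableSet_le (by fun_prop) hd) (by fun_prop) (by fun_prop))))

theorem generation_mem_Icc : sys.generation s d ∈ Set.Icc 0 sys.Gmax := by
  have := sys.Gmax_nonneg
  simp only [generation, policy]
  split_ifs <;> constructor <;> simp only <;> linarith

theorem lt_generation_iff (hg0 : 0 ≤ g) (hg : g < sys.Gmax) :
    g < sys.generation s d ↔ d < -(g + sys.ad * s) := by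
  have hstored : 0 ≤ sys.ad * s := mul_nonneg sys.ad_pos.le s.2.1
  have hroom : 0 ≤ (sys.Smax - s) / sys.ac := div_nonneg (sub_nonneg.2 s.2.2) sys.ac_pos.le
  simp only [generation, policy]
  split_ifs <;> simp only <;> constructor <;> intro h <;> linarith

theorem isMarkovKernel_kernel (hlam : 0 < lam) : IsMarkovKernel (sys.kernel lam) := by
  have := isProbabilityMeasure_laplaceMeasure hlam
  exact ⟨fun s => Measure.isProbabilityMeasure_map
    (sys.measurable_step.comp measurable_prodMk_left).aemeasurable⟩

theorem kernel_apply {A : Set sys.Level} (hA : MeasurableSet A) :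
    sys.kernel lam s A = laplaceMeasure lam (sys.step s ⁻¹' A) :=
  Measure.map_apply (sys.measurable_step.comp measurable_prodMk_left) hA

theorem kernel_Ioi (hlam : 0 < lam) (hst : s ≤ t) (ht : (t : ℝ) < sys.Smax) :
    sys.kernel lam s (Set.Ioi t) =
      ENNReal.ofReal (Real.exp (-(lam / sys.ac * (t - s))) / 2) := by
  have hset : sys.step s ⁻¹' Set.Ioi t = Set.Ioi ((t - s) / sys.ac) :=
    Set.ext fun d => sys.lt_step_iff hst ht
  rw [kernel_apply sys measurableSet_Ioi, hset,
    laplaceMeasure_Ioi_of_nonneg hlam (div_nonneg (sub_nonneg.2 hst) sys.ac_pos.le),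
    div_mul_eq_mul_div, mul_div_assoc]

theorem kernel_Iic (hlam : 0 < lam) (hts : t < s) :
    sys.kernel lam s (Set.Iic t) =
      ENNReal.ofReal (Real.exp (-(lam * sys.ad * (s - t))) / 2) := by
  have hset : sys.step s ⁻¹' Set.Iic t = Set.Iic (-(sys.ad * (s - t))) :=
    Set.ext fun d => sys.step_le_iff hts
  have hloss : 0 ≤ sys.ad * (s - t) := mul_nonneg sys.ad_pos.le (sub_nonneg.2 hts.le)
  rw [kernel_apply sys measurableSet_Iic, hset,
    laplaceMeasure_Iic_of_nonpos hlam (neg_nonpos.2 hloss), mul_neg, mul_assoc]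

theorem smul_dirac_zero_le_kernel :
    laplaceMeasure lam (Set.Iio (-(sys.ad * sys.Smax))) •
      Measure.dirac (⟨0, Set.left_mem_Icc.2 sys.Smax_nonneg⟩ : sys.Level) ≤
        sys.kernel lam s := by
  refine Measure.le_iff.2 fun A hA => ?_
  rw [kernel_apply sys hA, Measure.smul_apply, Measure.dirac_apply' _ hA, smul_eq_mul]
  by_cases h0 : (⟨0, Set.left_mem_Icc.2 sys.Smax_nonneg⟩ : sys.Level) ∈ A
  · rw [Set.indicator_of_mem h0, Pi.one_apply, mul_one]
    refine measure_mono fun d hd => ?_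
    rwa [Set.mem_preimage, sys.step_eq_zero hd]
  · simp [Set.indicator_of_notMem h0]

theorem eq_of_invariant_kernel (hlam : 0 < lam) {μ ν : Measure sys.Level}
    [IsProbabilityMeasure μ] [IsProbabilityMeasure ν] (hμ : (sys.kernel lam).Invariant μ)
    (hν : (sys.kernel lam).Invariant ν) : μ = ν := by
  have := isMarkovKernel_kernel sys hlam
  have hloss : 0 ≤ sys.ad * sys.Smax := mul_nonneg sys.ad_pos.le sys.Smax_nonneg
  have hpos : laplaceMeasure lam (Set.Iio (-(sys.ad * sys.Smax))) ≠ 0 := by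
    rw [laplaceMeasure_Iio_of_nonpos hlam (neg_nonpos.2 hloss)]
    exact (ENNReal.ofReal_pos.2 (by positivity)).ne'
  refine eq_of_invariant_of_le ?_ (fun s => sys.smul_dirac_zero_le_kernel) hμ hν
  rw [← Measure.measure_univ_ne_zero, Measure.smul_apply, measure_univ, smul_eq_mul, mul_one]
  exact hpos

theorem comp_kernel_eq_map_prod (μ : Measure sys.Level) :
    sys.kernel lam ∘ₘ μ = (μ.prod (laplaceMeasure lam)).map fun p => sys.step p.1 p.2 := by
  ext A hA
  rw [Measure.bind_apply hA (Kernel.aemeasurable _), Measure.map_apply sys.measurable_step hA,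
    Measure.prod_apply (sys.measurable_step hA)]
  exact lintegral_congr fun s => sys.kernel_apply hA

theorem generationLaw_Ioi (hlam : 0 < lam) (μ : Measure sys.Level) (hg0 : 0 ≤ g)
    (hg : g < sys.Gmax) :
    sys.generationLaw lam μ (Set.Ioi g) =
      ∫⁻ s : sys.Level, ENNReal.ofReal (Real.exp (-(lam * (g + sys.ad * s))) / 2) ∂μ := by
  rw [generationLaw, Measure.map_apply sys.measurable_generation measurableSet_Ioi,
    Measure.prod_apply (sys.measurable_generation measurableSet_Ioi)]
  refine lintegral_congr fun s => ?_
  have hset : Prod.mk s ⁻¹' ((fun p : sys.Level × ℝ => sys.generation p.1 p.2) ⁻¹' Set.Ioi g) =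
      Set.Iio (-(g + sys.ad * s)) :=
    Set.ext fun d => sys.lt_generation_iff hg0 hg
  have hstored : 0 ≤ sys.ad * s := mul_nonneg sys.ad_pos.le s.2.1
  rw [hset, laplaceMeasure_Iio_of_nonpos hlam (by linarith), mul_neg]

theorem isProbabilityMeasure_generationLaw (hlam : 0 < lam) (μ : Measure sys.Level)
    [IsProbabilityMeasure μ] : IsProbabilityMeasure (sys.generationLaw lam μ) := by
  have := isProbabilityMeasure_laplaceMeasure hlam
  exact Measure.isProbabilityMeasure_map sys.measurable_generation.aemeasurable

theorem ae_generationLaw_mem_Icc (μ : Measure sys.Level) :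
    ∀ᵐ x ∂(sys.generationLaw lam μ), x ∈ Set.Icc 0 sys.Gmax :=
  (ae_map_iff sys.measurable_generation.aemeasurable measurableSet_Icc).2
    (ae_of_all _ fun _ => sys.generation_mem_Icc)

end StorageSystem

namespace StorageSystem

variable (sys : StorageSystem)

/-- The rate `β` at which the density of the stationary stored power decays; it is half the
difference of the rates `lam / ac` of upward moves and `lam * ad` of downward moves. -/
noncomputable def decayRate (lam : ℝ) : ℝ := (1 / sys.ac - sys.ad) * lam / 2

/-- The mean `γ` of the rates `lam / ac` of upward moves and `lam * ad` of downward moves. -/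
noncomputable def meanRate (lam : ℝ) : ℝ := (1 / sys.ac + sys.ad) * lam / 2

/-- The mass of the stationary stored power at `0` if `0 < Smax`; if `Smax = 0`, it is half of the
total mass, because the atoms at both ends coincide. -/
noncomputable def atomZero (lam : ℝ) : ℝ :=
  (1 - sys.eff) / (2 * (1 - sys.eff * Real.exp (-(sys.decayRate lam * sys.Smax))))

/-- The stationary law of the stored power. -/
noncomputable def stationaryLaw (lam : ℝ) : Measure sys.Level :=
  (endpointMeasure sys.Smax_nonneg (sys.meanRate lam)).withDensity fun s =>
    ENNReal.ofReal (sys.atomZero lam * Real.exp (-(sys.decayRate lam * s)))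

variable {lam : ℝ}

theorem eff_pos : 0 < sys.eff := mul_pos sys.ac_pos sys.ad_pos

theorem eff_lt_one : sys.eff < 1 :=
  mul_lt_one_of_nonneg_of_lt_one_left sys.ac_pos.le sys.ac_lt_one sys.ad_lt_one.le

theorem meanRate_add_decayRate : sys.meanRate lam + sys.decayRate lam = lam / sys.ac := by
  simp only [meanRate, decayRate]; ring

theorem meanRate_sub_decayRate : sys.meanRate lam - sys.decayRate lam = lam * sys.ad := by
  simp only [meanRate, decayRate]; ring

theorem meanRate_mul_one_sub_eff :
    sys.meanRate lam * (1 - sys.eff) = sys.decayRate lam * (1 + sys.eff) := by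
  have := sys.ac_pos.ne'
  simp only [meanRate, decayRate, eff]
  field_simp

theorem neg_decayRate_mul (s : ℝ) :
    -(1 / sys.ac - sys.ad) * lam * s / 2 = -(sys.decayRate lam * s) := by
  rw [decayRate]; ring

theorem decayRate_nonneg (hlam : 0 ≤ lam) : 0 ≤ sys.decayRate lam := by
  have : 1 ≤ 1 / sys.ac := (one_le_div sys.ac_pos).2 sys.ac_lt_one.le
  exact div_nonneg (mul_nonneg (sub_nonneg.2 (sys.ad_lt_one.le.trans this)) hlam) zero_le_two

theorem meanRate_nonneg (hlam : 0 ≤ lam) : 0 ≤ sys.meanRate lam :=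
  div_nonneg (mul_nonneg (add_nonneg (one_div_pos.2 sys.ac_pos).le sys.ad_pos.le) hlam) zero_le_two

theorem one_sub_eff_mul_exp_pos (hlam : 0 ≤ lam) :
    0 < 1 - sys.eff * Real.exp (-(sys.decayRate lam * sys.Smax)) := by
  have hexp : Real.exp (-(sys.decayRate lam * sys.Smax)) ≤ 1 := Real.exp_le_one_iff.2
    (neg_nonpos.2 (mul_nonneg (sys.decayRate_nonneg hlam) sys.Smax_nonneg))
  exact sub_pos.2 ((mul_le_of_le_one_right sys.eff_pos.le hexp).trans_lt sys.eff_lt_one)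

theorem atomZero_nonneg (hlam : 0 ≤ lam) : 0 ≤ sys.atomZero lam :=
  div_nonneg (sub_nonneg.2 sys.eff_lt_one.le)
    (mul_nonneg zero_le_two (sys.one_sub_eff_mul_exp_pos hlam).le)

theorem meanRate_mul_integral_exp_decayRate (t : ℝ) :
    sys.meanRate lam * ∫ s in (0 : ℝ)..t, Real.exp (-(sys.decayRate lam * s)) =
      (1 + sys.eff) / (1 - sys.eff) * (1 - Real.exp (-(sys.decayRate lam * t))) := by
  have heff : 1 - sys.eff ≠ 0 := (sub_pos.2 sys.eff_lt_one).ne'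
  have hint := mul_integral_exp_neg_mul (sys.decayRate lam) 0 t
  rw [mul_zero, neg_zero, Real.exp_zero] at hint
  rw [← hint, div_mul_eq_mul_div, eq_div_iff heff, mul_right_comm, meanRate_mul_one_sub_eff]
  ring

theorem atomZero_mul_one_add_meanRate_mul_integral (hlam : 0 ≤ lam) (t : ℝ) :
    sys.atomZero lam *
        (1 + sys.meanRate lam * ∫ s in (0 : ℝ)..t, Real.exp (-(sys.decayRate lam * s))) =
      (1 - (1 + sys.eff) / 2 * Real.exp (-(sys.decayRate lam * t))) /
        (1 - sys.eff * Real.exp (-(sys.decayRate lam * sys.Smax))) := by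
  have heff : 1 - sys.eff ≠ 0 := (sub_pos.2 sys.eff_lt_one).ne'
  have hnorm := (sys.one_sub_eff_mul_exp_pos hlam).ne'
  rw [meanRate_mul_integral_exp_decayRate, atomZero]
  field_simp
  ring

-- For a jump probability `g` of rate `γ + β` or `γ - β`, the function `h` has the rate `γ`.
theorem setLIntegral_stationaryLaw (hlam : 0 ≤ lam) {g h : ℝ → ℝ} (hg : Measurable g) {c : ℝ}
    (hc : 0 ≤ c) (hgh : ∀ s, Real.exp (-(sys.decayRate lam * s)) * g s = c * h s)
    {A : Set sys.Level} (hA : MeasurableSet A) :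
    ∫⁻ s in A, ENNReal.ofReal (g s) ∂(sys.stationaryLaw lam) =
      ENNReal.ofReal (sys.atomZero lam * c) *
        ∫⁻ s in A, ENNReal.ofReal (h s) ∂(endpointMeasure sys.Smax_nonneg (sys.meanRate lam)) := by
  have ha := sys.atomZero_nonneg hlam
  rw [stationaryLaw, setLIntegral_withDensity_eq_setLIntegral_mul _ (by fun_prop)
      (g := fun s : sys.Level => ENNReal.ofReal (g s)) (by fun_prop) hA,
    ← lintegral_const_mul' _ _ ENNReal.ofReal_ne_top]
  refine lintegral_congr fun s => ?_
  rw [Pi.mul_apply, ← ENNReal.ofReal_mul (mul_nonneg ha (Real.exp_pos _).le),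
    ← ENNReal.ofReal_mul (mul_nonneg ha hc), mul_assoc, hgh, mul_assoc]

theorem stationaryLaw_apply (hlam : 0 ≤ lam) {A : Set sys.Level} (hA : MeasurableSet A) :
    sys.stationaryLaw lam A = ENNReal.ofReal (sys.atomZero lam) *
      ∫⁻ s in A, ENNReal.ofReal (Real.exp (-(sys.decayRate lam * s)))
        ∂(endpointMeasure sys.Smax_nonneg (sys.meanRate lam)) := by
  have h := sys.setLIntegral_stationaryLaw hlam (g := fun _ => 1) measurable_const zero_le_one
    (fun s => mul_comm _ _) hA
  simpa using h

theorem isProbabilityMeasure_stationaryLaw (hlam : 0 ≤ lam) :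
    IsProbabilityMeasure (sys.stationaryLaw lam) := by
  constructor
  have ha := sys.atomZero_nonneg hlam
  have hnorm := (sys.one_sub_eff_mul_exp_pos hlam).ne'
  rw [sys.stationaryLaw_apply hlam .univ, setLIntegral_univ,
    lintegral_endpointMeasure _ (g := fun s => Real.exp (-(sys.decayRate lam * s)))
      (sys.meanRate_nonneg hlam) (by fun_prop) (fun _ => (Real.exp_pos _).le),
    ← ENNReal.ofReal_mul ha, ENNReal.ofReal_eq_one, mul_zero, neg_zero, Real.exp_zero,
    add_right_comm, mul_add, sys.atomZero_mul_one_add_meanRate_mul_integral hlam, atomZero]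
  field_simp
  ring

section Invariance

variable {t : sys.Level}

theorem setLIntegral_Iic_kernel_Ioi_stationaryLaw (hlam : 0 < lam) (ht : (t : ℝ) < sys.Smax) :
    ∫⁻ s in Set.Iic t, sys.kernel lam s (Set.Ioi t) ∂(sys.stationaryLaw lam) =
      ENNReal.ofReal (sys.atomZero lam * (Real.exp (-(sys.decayRate lam * t)) / 2)) := by
  rw [setLIntegral_congr_fun measurableSet_Iic fun s hs => sys.kernel_Ioi hlam hs ht,
    sys.setLIntegral_stationaryLaw hlam.le
      (g := fun s => Real.exp (-(lam / sys.ac * (t - s))) / 2) (by fun_prop)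
      (c := Real.exp (-(sys.decayRate lam * t)) / 2) (by positivity)
      (h := fun s => Real.exp (-(sys.meanRate lam * (t - s)))) ?_ measurableSet_Iic,
    setLIntegral_Iic_endpointMeasure_exp _ (sys.meanRate_nonneg hlam.le) ht, mul_one]
  intro s
  rw [← meanRate_add_decayRate, mul_div_assoc', div_mul_eq_mul_div, ← Real.exp_add, ← Real.exp_add]
  ring_nf

theorem setLIntegral_Ioi_kernel_Iic_stationaryLaw (hlam : 0 < lam) (ht : (t : ℝ) < sys.Smax) :
    ∫⁻ s in Set.Ioi t, sys.kernel lam s (Set.Iic t) ∂(sys.stationaryLaw lam) =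
      ENNReal.ofReal (sys.atomZero lam * (Real.exp (-(sys.decayRate lam * t)) / 2)) := by
  rw [setLIntegral_congr_fun measurableSet_Ioi fun s hs => sys.kernel_Iic hlam hs,
    sys.setLIntegral_stationaryLaw hlam.le
      (g := fun s => Real.exp (-(lam * sys.ad * (s - t))) / 2) (by fun_prop)
      (c := Real.exp (-(sys.decayRate lam * t)) / 2) (by positivity)
      (h := fun s => Real.exp (-(sys.meanRate lam * (s - t)))) ?_ measurableSet_Ioi,
    setLIntegral_Ioi_endpointMeasure_exp _ (sys.meanRate_nonneg hlam.le) ht, mul_one]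
  intro s
  rw [← meanRate_sub_decayRate, mul_div_assoc', div_mul_eq_mul_div, ← Real.exp_add, ← Real.exp_add]
  ring_nf

theorem invariant_stationaryLaw (hlam : 0 < lam) :
    (sys.kernel lam).Invariant (sys.stationaryLaw lam) := by
  have := sys.isProbabilityMeasure_stationaryLaw hlam.le
  have := sys.isMarkovKernel_kernel hlam
  refine invariant_of_setLIntegral_Iic_eq_setLIntegral_Ioi fun t => ?_
  rcases t.2.2.lt_or_eq with ht | ht
  · rw [sys.setLIntegral_Iic_kernel_Ioi_stationaryLaw hlam ht,
      sys.setLIntegral_Ioi_kernel_Iic_stationaryLaw hlam ht]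
  · have hempty : Set.Ioi t = ∅ := Set.Ioi_eq_empty_iff.2 fun s _ => s.2.2.trans ht.ge
    simp [hempty]

end Invariance

theorem stationaryLaw_Iic (hlam : 0 ≤ lam) {t : sys.Level} (ht : (t : ℝ) < sys.Smax) :
    sys.stationaryLaw lam (Set.Iic t) = ENNReal.ofReal
      ((1 - (1 + sys.eff) / 2 * Real.exp (-(sys.decayRate lam * t))) /
        (1 - sys.eff * Real.exp (-(sys.decayRate lam * sys.Smax)))) := by
  rw [sys.stationaryLaw_apply hlam measurableSet_Iic,
    setLIntegral_Iic_endpointMeasure _ (g := fun s => Real.exp (-(sys.decayRate lam * s)))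
      (sys.meanRate_nonneg hlam) (by fun_prop) (fun _ => (Real.exp_pos _).le) ht,
    ← ENNReal.ofReal_mul (sys.atomZero_nonneg hlam), mul_zero, neg_zero, Real.exp_zero,
    sys.atomZero_mul_one_add_meanRate_mul_integral hlam]

theorem cdf_stationaryLaw (hlam : 0 ≤ lam) (s : ℝ) :
    cdf ((sys.stationaryLaw lam).map Subtype.val) s = sys.storedCDF lam s := by
  have := sys.isProbabilityMeasure_stationaryLaw hlam
  have := Measure.isProbabilityMeasure_map (μ := sys.stationaryLaw lam)
    measurable_subtype_coe.aemeasurable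
  have hmem : ∀ᵐ x ∂((sys.stationaryLaw lam).map Subtype.val), x ∈ Set.Icc 0 sys.Smax :=
    (ae_map_iff measurable_subtype_coe.aemeasurable measurableSet_Icc).2
      (ae_of_all _ Subtype.property)
  rw [storedCDF]
  split_ifs with hneg hlt
  · exact cdf_eq_zero_of_ae_lt (hmem.mono fun x hx => hneg.trans_le hx.1)
  · have hs0 := not_lt.1 hneg
    have hpos : 0 ≤ (1 - (1 + sys.eff) / 2 * Real.exp (-(sys.decayRate lam * s))) /
        (1 - sys.eff * Real.exp (-(sys.decayRate lam * sys.Smax))) := by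
      rw [← sys.atomZero_mul_one_add_meanRate_mul_integral hlam]
      exact mul_nonneg (sys.atomZero_nonneg hlam) (add_nonneg zero_le_one
        (mul_nonneg (sys.meanRate_nonneg hlam)
          (intervalIntegral.integral_nonneg hs0 fun _ _ => (Real.exp_pos _).le)))
    rw [cdf_eq_real, map_measureReal_apply measurable_subtype_coe measurableSet_Iic, Measure.real,
      neg_decayRate_mul, neg_decayRate_mul, ← ENNReal.toReal_ofReal hpos]
    exact congrArg ENNReal.toReal (sys.stationaryLaw_Iic hlam (t := ⟨s, hs0, hlt.le⟩) hlt)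
  · exact cdf_eq_one_of_ae_le (hmem.mono fun x hx => hx.2.trans (not_lt.1 hlt))

theorem real_map_val_stationaryLaw_singleton (hlam : 0 ≤ lam) {x : sys.Level}
    (hx : endpointMeasure sys.Smax_nonneg (sys.meanRate lam) {x} = 1) :
    ((sys.stationaryLaw lam).map Subtype.val).real {(x : ℝ)} =
      sys.atomZero lam * Real.exp (-(sys.decayRate lam * x)) := by
  have hpre : Subtype.val ⁻¹' {(x : ℝ)} = ({x} : Set sys.Level) := by
    ext; simp [Subtype.ext_iff]
  rw [map_measureReal_apply measurable_subtype_coe (measurableSet_singleton _), hpre, Measure.real,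
    sys.stationaryLaw_apply hlam (measurableSet_singleton _), lintegral_singleton, hx, mul_one,
    ← ENNReal.ofReal_mul (sys.atomZero_nonneg hlam), ENNReal.toReal_ofReal
      (mul_nonneg (sys.atomZero_nonneg hlam) (Real.exp_pos _).le)]

theorem real_map_val_stationaryLaw_zero (hlam : 0 ≤ lam) (hM : 0 < sys.Smax) :
    ((sys.stationaryLaw lam).map Subtype.val).real {0} = sys.atomZero lam := by
  rw [sys.real_map_val_stationaryLaw_singleton hlam (endpointMeasure_singleton_left hM), mul_zero,
    neg_zero, Real.exp_zero, mul_one]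

theorem real_map_val_stationaryLaw_Smax (hlam : 0 ≤ lam) (hM : 0 < sys.Smax) :
    ((sys.stationaryLaw lam).map Subtype.val).real {sys.Smax} =
      sys.atomZero lam * Real.exp (-(sys.decayRate lam * sys.Smax)) :=
  sys.real_map_val_stationaryLaw_singleton hlam (endpointMeasure_singleton_right hM)

theorem generationLaw_stationaryLaw_Ioi (hlam : 0 < lam) {g : ℝ} (hg0 : 0 ≤ g)
    (hg : g < sys.Gmax) :
    sys.generationLaw lam (sys.stationaryLaw lam) (Set.Ioi g) =
      ENNReal.ofReal (sys.atomZero lam * Real.exp (-lam * g)) := by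
  rw [sys.generationLaw_Ioi hlam _ hg0 hg, ← setLIntegral_univ,
    sys.setLIntegral_stationaryLaw hlam.le
      (g := fun s => Real.exp (-(lam * (g + sys.ad * s))) / 2) (by fun_prop)
      (c := Real.exp (-lam * g) / 2) (by positivity)
      (h := fun s => Real.exp (-(sys.meanRate lam * (s - 0)))) ?_ .univ, setLIntegral_univ,
    lintegral_endpointMeasure_exp _ (sys.meanRate_nonneg hlam.le), ← ENNReal.ofReal_ofNat 2,
    ← ENNReal.ofReal_mul (by have := sys.atomZero_nonneg hlam.le; positivity), mul_assoc,
    div_mul_cancel₀ _ two_ne_zero]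
  intro s
  rw [mul_div_assoc', div_mul_eq_mul_div, ← Real.exp_add, ← Real.exp_add, mul_add, ← mul_assoc,
    ← meanRate_sub_decayRate]
  ring_nf

theorem cdf_generationLaw_stationaryLaw (hlam : 0 < lam) (g : ℝ) :
    cdf (sys.generationLaw lam (sys.stationaryLaw lam)) g = sys.generationCDF lam g := by
  have := sys.isProbabilityMeasure_stationaryLaw hlam.le
  have := sys.isProbabilityMeasure_generationLaw hlam (sys.stationaryLaw lam)
  have hmem := sys.ae_generationLaw_mem_Icc (lam := lam) (sys.stationaryLaw lam)
  rw [generationCDF]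
  split_ifs with hneg hlt
  · exact cdf_eq_zero_of_ae_lt (hmem.mono fun x hx => hneg.trans_le hx.1)
  · rw [cdf_eq_real, ← compl_compl (Set.Iic g), Set.compl_Iic,
      probReal_compl_eq_one_sub measurableSet_Ioi, Measure.real,
      sys.generationLaw_stationaryLaw_Ioi hlam (not_lt.1 hneg) hlt, ENNReal.toReal_ofReal
        (mul_nonneg (sys.atomZero_nonneg hlam.le) (Real.exp_pos _).le), neg_decayRate_mul, atomZero]
  · exact cdf_eq_one_of_ae_le (hmem.mono fun x hx => hx.2.trans (not_lt.1 hlt))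

end StorageSystem

namespace StorageSystem.IsStoredPower

variable {sys : StorageSystem} {lam : ℝ} {Ω : Type*} [MeasurableSpace Ω] {P : Measure Ω}
  {Δ : ℕ → Ω → ℝ} {S : ℕ → Ω → sys.Level}

theorem measurable (h : sys.IsStoredPower lam P Δ S) (i : ℕ) : Measurable (S i) :=
  measurable_of_recursion sys.measurable_step h.measurable_init h.measurable_error h.succ i

theorem indepFun_error (h : sys.IsStoredPower lam P Δ S) (i : ℕ) : IndepFun (S i) (Δ i) P :=
  indepFun_of_recursion sys.measurable_step h.measurable_init h.measurable_error h.succ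
    h.iIndep_error h.indep_init i

theorem map_prodMk (h : sys.IsStoredPower lam P Δ S) (i : ℕ) :
    P.map (fun ω => (S i ω, Δ i ω)) = (P.map (S i)).prod (laplaceMeasure lam) := by
  have := h.iIndep_error.isProbabilityMeasure
  rw [← h.law_error i]
  exact (indepFun_iff_map_prod_eq_prod_map_map (h.measurable i).aemeasurable
    (h.measurable_error i).aemeasurable).1 (h.indepFun_error i)

theorem map_succ (h : sys.IsStoredPower lam P Δ S) (i : ℕ) :
    P.map (S (i + 1)) = sys.kernel lam ∘ₘ P.map (S i) := by
  rw [comp_kernel_eq_map_prod, ← h.map_prodMk i,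
    Measure.map_map sys.measurable_step ((h.measurable i).prodMk (h.measurable_error i))]
  exact congrArg P.map (funext (h.succ i))

theorem map_eq_map_zero_iff_invariant (h : sys.IsStoredPower lam P Δ S) :
    (∀ i, P.map (S i) = P.map (S 0)) ↔ (sys.kernel lam).Invariant (P.map (S 0)) := by
  refine ⟨fun hid => (h.map_succ 0).symm.trans (hid 1), fun hinv i => ?_⟩
  induction i with
  | zero => rfl
  | succ i ih => rw [h.map_succ, ih, hinv.def]

theorem map_generation (h : sys.IsStoredPower lam P Δ S) (i : ℕ) :
    P.map (fun ω => sys.generation (S i ω) (Δ i ω)) = sys.generationLaw lam (P.map (S i)) := by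
  rw [generationLaw, ← h.map_prodMk i, Measure.map_map sys.measurable_generation
    ((h.measurable i).prodMk (h.measurable_error i))]
  rfl

theorem map_eq_map_zero_iff_eq_stationaryLaw (h : sys.IsStoredPower lam P Δ S) (hlam : 0 < lam) :
    (∀ i, P.map (S i) = P.map (S 0)) ↔ P.map (S 0) = sys.stationaryLaw lam := by
  have := h.iIndep_error.isProbabilityMeasure
  have := sys.isProbabilityMeasure_stationaryLaw hlam.le
  have := Measure.isProbabilityMeasure_map (μ := P) h.measurable_init.aemeasurable
  have hstat := sys.invariant_stationaryLaw hlam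
  exact h.map_eq_map_zero_iff_invariant.trans
    ⟨fun hinv => sys.eq_of_invariant_kernel hlam hinv hstat, fun heq => heq ▸ hstat⟩

theorem cdf_generation (h : sys.IsStoredPower lam P Δ S) (hlam : 0 < lam)
    (hinit : P.map (S 0) = sys.stationaryLaw lam) (i : ℕ) (g : ℝ) :
    cdf (P.map fun ω => sys.generation (S i ω) (Δ i ω)) g = sys.generationCDF lam g := by
  rw [h.map_generation, (h.map_eq_map_zero_iff_eq_stationaryLaw hlam).2 hinit i, hinit,
    sys.cdf_generationLaw_stationaryLaw hlam]

end StorageSystem.IsStoredPower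

theorem proposition3 (sys : StorageSystem) (lam : ℝ) (hlam : 0 < lam) :
    ∃ π : Measure sys.Level, IsProbabilityMeasure π ∧
      -- `π` is the unique stationary distribution of the stored power chain
      (sys.kernel lam).Invariant π ∧
      (∀ ν : Measure sys.Level, IsProbabilityMeasure ν → (sys.kernel lam).Invariant ν → ν = π) ∧
      -- its cdf
      (∀ s : ℝ, cdf (π.map Subtype.val) s = sys.storedCDF lam s) ∧
      -- its atoms at the two ends
      (0 < sys.Smax →
        (π.map Subtype.val).real {0} = (1 - sys.eff) /
          (2 * (1 - sys.eff * Real.exp (-(1 / sys.ac - sys.ad) * lam * sys.Smax / 2))) ∧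
        (π.map Subtype.val).real {sys.Smax} =
          (1 - sys.eff) * Real.exp (-(1 / sys.ac - sys.ad) * lam * sys.Smax / 2) /
          (2 * (1 - sys.eff * Real.exp (-(1 / sys.ac - sys.ad) * lam * sys.Smax / 2)))) ∧
      -- the cdf of the corresponding fast-ramping generation
      IsProbabilityMeasure (sys.generationLaw lam π) ∧
      (∀ g : ℝ, cdf (sys.generationLaw lam π) g = sys.generationCDF lam g) ∧
      -- the same for the stored power sequence driven by IID Laplace prediction errors
      (∀ (Ω : Type*) [MeasurableSpace Ω] (P : Measure Ω) [IsProbabilityMeasure P]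
        (Δ : ℕ → Ω → ℝ) (S : ℕ → Ω → sys.Level), sys.IsStoredPower lam P Δ S →
        ((∀ i, P.map (S i) = P.map (S 0)) ↔ P.map (S 0) = π) ∧
        (P.map (S 0) = π → ∀ (i : ℕ) (g : ℝ),
          cdf (P.map fun ω => sys.generation (S i ω) (Δ i ω)) g = sys.generationCDF lam g)) := by
  have hπ := sys.isProbabilityMeasure_stationaryLaw hlam.le
  refine ⟨sys.stationaryLaw lam, hπ, sys.invariant_stationaryLaw hlam,
    fun ν _ hν => sys.eq_of_invariant_kernel hlam hν (sys.invariant_stationaryLaw hlam),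
    sys.cdf_stationaryLaw hlam.le, fun hM => ⟨?_, ?_⟩,
    sys.isProbabilityMeasure_generationLaw hlam _, sys.cdf_generationLaw_stationaryLaw hlam,
    fun Ω _ P _ Δ S hS => ⟨hS.map_eq_map_zero_iff_eq_stationaryLaw hlam, hS.cdf_generation hlam⟩⟩
  · rw [sys.real_map_val_stationaryLaw_zero hlam.le hM, StorageSystem.atomZero,
      sys.neg_decayRate_mul]
  · rw [sys.real_map_val_stationaryLaw_Smax hlam.le hM, StorageSystem.atomZero,
      sys.neg_decayRate_mul, div_mul_eq_mul_div]
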